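/- Let $Q$ be an orbifold, not assumed to be reduced: a Hausdorff space with a compatible atlas of charts $\{V,G,\pi\}$, where $V\subseteq\mathbb{R}^n$ is open and connected, $G$ is a finite group acting smoothly (not necessarily effectively) on $V$, and $\pi$ induces a homeomorphism of $V/G$ onto an open subset of $Q$. Let $\rho:E\to Q$ be an orbifold vector bundle of rank $k$ (good or bad), with charts $\{V\times\mathbb{R}^k,G,\tilde\pi\}$ over charts $\{V,G,\pi\}$ of $Q$, where $G$ acts on $V\times\mathbb{R}^k$ by diffeomorphisms which cover the action on $V$ and are linear on the fibers. These charts also make the total space $E$ an orbifold. Let $TE\to E$ be its orbifold tangent bundle, and let $\rho_{VE}:VE\to E$ be the vertical tangent bundle: the orbifold vector bundle over $E$ that consists of those vectors in $TE$ each of whose lifts to $T(V\times\mathbb{R}^k)$, for every chart $\{V\times\mathbb{R}^k,G,\tilde\pi\}$, is tangent to the fibers of $V\times\mathbb{R}^k\to V$. A section of an orbifold vector bundle is a map $s$ from the base to the total space with $(\text{projection})\circ s=\mathrm{id}$ that is covered, in each chart, by a smooth $G$-equivariant section of the trivial bundle $V\times\mathbb{R}^k\to V$; it is nonvanishing if it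 takes no value in the zero section. Then $\rho:E\to Q$ admits a nonvanishing section if and only if $\rho_{VE}:VE\to E$ admits a nonvanishing section. -/

import Mathlib

open Set Topology
open scoped ContDiff

/-- An orbifold chart (uniformizing system) `(V, G, π)` on the space `X`: a connected open subset `V`
of the model space `H` (a copy of `ℝⁿ`), a finite group `G` acting smoothly, not necessarily
effectively, on `V`, and a map `π : V → X` which induces a homeomorphism of `V / G` onto an open
subset of `X`. The values of `act g` and `π` outside of `V` are irrelevant. -/
structure OrbifoldChart (H : Type*) [NormedAddCommGroup H] [NormedSpace ℝ H]
    (X : Type*) [TopologicalSpace X] where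
  V : Set H
  isOpen_V : IsOpen V
  isConnected_V : IsConnected V
  G : Type
  [group : Group G]
  [finite : Finite G]
  act : G → H → H
  act_mem : ∀ g, ∀ x ∈ V, act g x ∈ V
  act_one : ∀ x ∈ V, act 1 x = x
  act_mul : ∀ g h, ∀ x ∈ V, act (g * h) x = act g (act h x)
  act_smooth : ∀ g, ContDiffOn ℝ ∞ (act g) V
  π : H → X
  π_cont : ContinuousOn π V
  π_open : ∀ O ⊆ V, IsOpen O → IsOpen (π '' O)
  π_eq_iff : ∀ x ∈ V, ∀ y ∈ V, π x = π y ↔ ∃ g, act g x = y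

attribute [instance] OrbifoldChart.group OrbifoldChart.finite

/-- The open subset of `X` uniformized by the chart. -/
def OrbifoldChart.U {H : Type*} [NormedAddCommGroup H] [NormedSpace ℝ H]
    {X : Type*} [TopologicalSpace X] (c : OrbifoldChart H X) : Set X := c.π '' c.V

/-- An injection of orbifold charts `(V, G, π) → (V', G', π')`: a smooth open embedding `φ : V → V'`
(a diffeomorphism onto an open subset) over the identity of `X`, equivariant along an injective
homomorphism `lam : G → G'`. The condition `full` says that every element of `G'` which moves some
point of `φ(V)` into `φ(V)` comes from `G` (so that `(V, G, π)` is the chart induced by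
`(V', G', π')` on `π(V)`); for effective actions this is automatic, and in general it amounts to
`lam` being an isomorphism between the kernels of the two actions. -/
structure OrbifoldChart.Injection {H : Type*} [NormedAddCommGroup H] [NormedSpace ℝ H]
    {X : Type*} [TopologicalSpace X] (c d : OrbifoldChart H X) where
  φ : OpenPartialHomeomorph H H
  source_eq : φ.source = c.V
  target_subset : φ.target ⊆ d.V
  smooth : ContDiffOn ℝ ∞ φ φ.source
  smooth_symm : ContDiffOn ℝ ∞ φ.symm φ.target
  π_comp : ∀ x ∈ c.V, d.π (φ x) = c.π x
  lam : c.G →* d.G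
  lam_injective : Function.Injective lam
  equivariant : ∀ g, ∀ x ∈ c.V, φ (c.act g x) = d.act (lam g) (φ x)
  full : ∀ g : d.G, ∀ x ∈ c.V, ∀ y ∈ c.V, d.act g (φ x) = φ y → g ∈ Set.range lam

/-- Two charts define the same germ at `q`: some chart around `q` injects into both. -/
def OrbifoldChart.EquivAt {H : Type*} [NormedAddCommGroup H] [NormedSpace ℝ H]
    {X : Type*} [TopologicalSpace X] (c d : OrbifoldChart H X) (q : X) : Prop :=
  ∃ e : OrbifoldChart H X, q ∈ e.U ∧ Nonempty (e.Injection c) ∧ Nonempty (e.Injection d)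

/-- A (possibly unreduced) orbifold structure, with charts in `H`, on the Hausdorff space `X`. -/
structure Orbifold (H : Type*) [NormedAddCommGroup H] [NormedSpace ℝ H]
    (X : Type*) [TopologicalSpace X] where
  t2 : T2Space X
  ι : Type*
  chart : ι → OrbifoldChart H X
  cover : ∀ q, ∃ i, q ∈ (chart i).U
  compat : ∀ i j, ∀ q ∈ (chart i).U ∩ (chart j).U, (chart i).EquivAt (chart j) q

/-- A uniformizing system `(V × F, G, πE)`, over an orbifold chart `(V, G, π)` of `X`, for the part of
`p : Y → X` over `π(V)`. The group `G` acts on `V × F` by `g (x, v) = (g x, ρ g x v)`, linearly on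
the fibers. -/
structure OrbibundleChart {H : Type*} [NormedAddCommGroup H] [NormedSpace ℝ H]
    (F : Type*) [NormedAddCommGroup F] [NormedSpace ℝ F]
    {X Y : Type*} [TopologicalSpace X] [TopologicalSpace Y] (p : Y → X)
    extends OrbifoldChart H X where
  ρ : G → H → (F →L[ℝ] F)
  ρ_one : ∀ x ∈ V, ρ 1 x = ContinuousLinearMap.id ℝ F
  ρ_mul : ∀ g h, ∀ x ∈ V, ρ (g * h) x = (ρ g (act h x)).comp (ρ h x)
  ρ_smooth : ∀ g, ContDiffOn ℝ ∞ (ρ g) V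
  πE : H × F → Y
  πE_cont : ContinuousOn πE (V ×ˢ univ)
  πE_open : ∀ O ⊆ V ×ˢ univ, IsOpen O → IsOpen (πE '' O)
  πE_eq_iff : ∀ x ∈ V, ∀ v, ∀ y ∈ V, ∀ w,
    πE (x, v) = πE (y, w) ↔ ∃ g, act g x = y ∧ ρ g x v = w
  πE_proj : ∀ x ∈ V, ∀ v, p (πE (x, v)) = π x
  πE_surj : ∀ e, p e ∈ π '' V → ∃ x ∈ V, ∃ v, πE (x, v) = e

/-- An injection of uniformizing systems of orbibundles: an injection of the base charts, covered by
`(x, v) ↦ (φ x, A x v)` with `A x ∈ GL(F)` depending smoothly on `x ∈ V`. -/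
structure OrbibundleChart.Injection {H : Type*} [NormedAddCommGroup H] [NormedSpace ℝ H]
    {F : Type*} [NormedAddCommGroup F] [NormedSpace ℝ F]
    {X Y : Type*} [TopologicalSpace X] [TopologicalSpace Y] {p : Y → X}
    (c d : OrbibundleChart (H := H) F p)
    extends OrbifoldChart.Injection c.toOrbifoldChart d.toOrbifoldChart where
  A : H → (F →L[ℝ] F)
  A_smooth : ContDiffOn ℝ ∞ A c.V
  A_inv : ∀ x ∈ c.V, (A x).IsInvertible
  A_equivariant : ∀ g, ∀ x ∈ c.V, (A (c.act g x)).comp (c.ρ g x) = (d.ρ (lam g) (φ x)).comp (A x)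
  πE_comp : ∀ x ∈ c.V, ∀ v, d.πE (φ x, A x v) = c.πE (x, v)

/-- The structure of an orbifold vector bundle with fiber `F` (a copy of `ℝᵏ`) over the orbifold `Q`
on the map `p : Y → X`: the base charts of the bundle charts are charts of `Q`, they cover `Q`, and
any two bundle charts define the same germ (of orbibundle) at each common point of the base. -/
structure OrbifoldVectorBundle {H : Type*} [NormedAddCommGroup H] [NormedSpace ℝ H]
    (F : Type*) [NormedAddCommGroup F] [NormedSpace ℝ F]
    {X Y : Type*} [TopologicalSpace X] [TopologicalSpace Y]
    (Q : Orbifold H X) (p : Y → X) where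
  ι : Type*
  chart : ι → OrbibundleChart (H := H) F p
  base_compat : ∀ i j, ∀ q ∈ (Q.chart i).U ∩ (chart j).U,
    (Q.chart i).EquivAt (chart j).toOrbifoldChart q
  cover : ∀ q, ∃ i, q ∈ (chart i).U
  compat : ∀ i j, ∀ q ∈ (chart i).U ∩ (chart j).U, ∃ e : OrbibundleChart (H := H) F p,
    q ∈ e.U ∧ Nonempty (e.Injection (chart i)) ∧ Nonempty (e.Injection (chart j))

namespace OrbifoldVectorBundle

variable {H : Type*} [NormedAddCommGroup H] [NormedSpace ℝ H]
  {F : Type*} [NormedAddCommGroup F] [NormedSpace ℝ F]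
  {X Y : Type*} [TopologicalSpace X] [TopologicalSpace Y]
  {Q : Orbifold H X} {p : Y → X}

/-- A (smooth) section of an orbifold vector bundle: a map `s : X → Y` with `p ∘ s = id` which is
covered, in each chart, by a smooth `G`-equivariant section `x ↦ (x, σ x)` of `V × F → V`. -/
structure IsSection (E : OrbifoldVectorBundle F Q p) (s : X → Y) : Prop where
  proj : ∀ q, p (s q) = q
  lift : ∀ i, ∃ σ : H → F, ContDiffOn ℝ ∞ σ (E.chart i).V ∧
    (∀ g, ∀ x ∈ (E.chart i).V, σ ((E.chart i).act g x) = (E.chart i).ρ g x (σ x)) ∧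
    (∀ x ∈ (E.chart i).V, (E.chart i).πE (x, σ x) = s ((E.chart i).π x))

/-- The point `e` of the total space lies on the zero section. -/
def IsZero (E : OrbifoldVectorBundle F Q p) (e : Y) : Prop :=
  ∃ i, ∃ x ∈ (E.chart i).V, (E.chart i).πE (x, 0) = e

/-- The bundle admits a nonvanishing section. -/
def HasNonvanishingSection (E : OrbifoldVectorBundle F Q p) : Prop :=
  ∃ s : X → Y, E.IsSection s ∧ ∀ q, ¬ E.IsZero (s q)

end OrbifoldVectorBundle

section Total

variable {H : Type*} [NormedAddCommGroup H] [NormedSpace ℝ H]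
  {F : Type*} [NormedAddCommGroup F] [NormedSpace ℝ F]
  {X Y : Type*} [TopologicalSpace X] [TopologicalSpace Y]

theorem OrbifoldChart.isOpen_U (c : OrbifoldChart H X) : IsOpen c.U :=
  c.π_open _ Subset.rfl c.isOpen_V

theorem OrbifoldChart.separate (c : OrbifoldChart H X) {x y : H} (hx : x ∈ c.V) (hy : y ∈ c.V)
    (hne : c.π x ≠ c.π y) :
    ∃ u v : Set X, IsOpen u ∧ IsOpen v ∧ c.π x ∈ u ∧ c.π y ∈ v ∧ Disjoint u v := by
  have h1 : ∀ g : c.G, ∃ O P : Set H, IsOpen O ∧ IsOpen P ∧ c.act g x ∈ O ∧ y ∈ P ∧ Disjoint O P := by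
    intro g
    apply t2_separation
    intro h
    exact hne ((c.π_eq_iff x hx y hy).2 ⟨g, h⟩)
  choose O P hO hP hxO hyP hOP using h1
  have hOo : IsOpen (⋂ g, (c.V ∩ c.act g ⁻¹' O g)) :=
    isOpen_iInter_of_finite fun g =>
      (c.act_smooth g).continuousOn.isOpen_inter_preimage c.isOpen_V (hO g)
  have hPo : IsOpen (c.V ∩ ⋂ g, P g) := c.isOpen_V.inter (isOpen_iInter_of_finite hP)
  refine ⟨c.π '' (⋂ g, (c.V ∩ c.act g ⁻¹' O g)), c.π '' (c.V ∩ ⋂ g, P g), c.π_open _ ?_ hOo,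
    c.π_open _ inter_subset_left hPo, ⟨x, ?_, rfl⟩, ⟨y, ⟨hy, mem_iInter.2 hyP⟩, rfl⟩, ?_⟩
  · intro z hz
    exact (mem_iInter.1 hz 1).1
  · exact mem_iInter.2 fun g => ⟨hx, hxO g⟩
  · rw [Set.disjoint_left]
    rintro _ ⟨a, ha, rfl⟩ ⟨b, hb, hab⟩
    have haV : a ∈ c.V := (mem_iInter.1 ha 1).1
    obtain ⟨g, hg⟩ := (c.π_eq_iff a haV b hb.1).1 hab.symm
    have h1 : c.act g a ∈ O g := (mem_iInter.1 ha g).2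
    rw [hg] at h1
    exact Set.disjoint_left.1 (hOP g) h1 (mem_iInter.1 hb.2 g)

/-- The chart `(V × F, G, πE)` of the total space given by a bundle chart. -/
def OrbibundleChart.total {p : Y → X} (c : OrbibundleChart (H := H) F p) :
    OrbifoldChart (H × F) Y where
  V := c.V ×ˢ univ
  isOpen_V := c.isOpen_V.prod isOpen_univ
  isConnected_V := c.isConnected_V.prod isConnected_univ
  G := c.G
  act g z := (c.act g z.1, c.ρ g z.1 z.2)
  act_mem g z hz := ⟨c.act_mem g _ hz.1, trivial⟩
  act_one z hz := by
    ext <;> simp [c.act_one _ hz.1, c.ρ_one _ hz.1]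
  act_mul g h z hz := by
    ext <;> simp [c.act_mul g h _ hz.1, c.ρ_mul g h _ hz.1]
  act_smooth g := by
    refine ContDiffOn.prodMk ((c.act_smooth g).comp contDiffOn_fst fun z hz => hz.1) ?_
    exact ((c.ρ_smooth g).comp contDiffOn_fst fun z hz => hz.1).clm_apply contDiffOn_snd
  π := c.πE
  π_cont := c.πE_cont
  π_open := c.πE_open
  π_eq_iff z hz w hw := by
    rw [← Prod.mk.eta (p := z), ← Prod.mk.eta (p := w), c.πE_eq_iff _ hz.1 _ _ hw.1]
    simp [Prod.ext_iff]

/-- Injections of bundle charts give injections of charts of the total space. -/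
noncomputable def OrbibundleChart.Injection.total [CompleteSpace F] {p : Y → X}
    {c d : OrbibundleChart (H := H) F p}
    (a : c.Injection d) : c.total.Injection d.total where
  φ :=
    { toFun := fun z => (a.φ z.1, a.A z.1 z.2)
      invFun := fun z => (a.φ.symm z.1, (a.A (a.φ.symm z.1)).inverse z.2)
      source := c.V ×ˢ univ
      target := a.φ.target ×ˢ univ
      map_source' := by
        rintro z ⟨hz, -⟩
        exact ⟨a.φ.map_source (a.source_eq ▸ hz), trivial⟩
      map_target' := by
        rintro z ⟨hz, -⟩
        exact ⟨a.source_eq ▸ a.φ.map_target hz, trivial⟩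
      left_inv' := by
        rintro z ⟨hz, -⟩
        have h1 : a.φ.symm (a.φ z.1) = z.1 := a.φ.left_inv (a.source_eq ▸ hz)
        ext
        · simp [h1]
        · simp only [h1]
          obtain ⟨e, he⟩ := a.A_inv _ hz
          simp [← he]
      right_inv' := by
        rintro z ⟨hz, -⟩
        have h2 : a.φ.symm z.1 ∈ c.V := a.source_eq ▸ a.φ.map_target hz
        ext
        · simp [a.φ.right_inv hz]
        · obtain ⟨e, he⟩ := a.A_inv _ h2
          simp [← he]
      open_source := c.isOpen_V.prod isOpen_univ
      open_target := a.φ.open_target.prod isOpen_univ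
      continuousOn_toFun := by
        refine ContinuousOn.prodMk ?_ ?_
        · exact a.φ.continuousOn.comp continuousOn_fst fun z hz => by
            rw [a.source_eq]; exact hz.1
        · exact (a.A_smooth.continuousOn.comp continuousOn_fst fun z hz => hz.1).clm_apply
            continuousOn_snd
      continuousOn_invFun := by
        have h : ContinuousOn (fun y => (a.A (a.φ.symm y)).inverse) a.φ.target := by
          intro y hy
          have h2 : a.φ.symm y ∈ c.V := a.source_eq ▸ a.φ.map_target hy
          obtain ⟨e, he⟩ := a.A_inv _ h2
          have h3 : ContinuousAt ContinuousLinearMap.inverse (a.A (a.φ.symm y)) := by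
            rw [← he]
            exact (contDiffAt_map_inverse (𝕜 := ℝ) (n := 0) e).continuousAt
          refine ContinuousAt.comp_continuousWithinAt (f := fun y => a.A (a.φ.symm y)) h3 ?_
          exact (a.A_smooth.continuousOn.comp a.φ.continuousOn_symm fun y hy =>
            a.source_eq ▸ a.φ.map_target hy) y hy
        refine ContinuousOn.prodMk ?_ ?_
        · exact a.φ.continuousOn_symm.comp continuousOn_fst fun z hz => hz.1
        · exact (h.comp continuousOn_fst fun z hz => hz.1).clm_apply continuousOn_snd }
  source_eq := rfl
  target_subset := fun z hz => ⟨a.target_subset hz.1, trivial⟩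
  smooth := by
    refine ContDiffOn.prodMk ?_ ?_
    · exact a.smooth.comp contDiffOn_fst fun z hz => by rw [a.source_eq]; exact hz.1
    · exact (a.A_smooth.comp contDiffOn_fst fun z hz => hz.1).clm_apply contDiffOn_snd
  smooth_symm := by
    have h : ContDiffOn ℝ ∞ (fun y => (a.A (a.φ.symm y)).inverse) a.φ.target := by
      intro y hy
      have h2 : a.φ.symm y ∈ c.V := a.source_eq ▸ a.φ.map_target hy
      obtain ⟨e, he⟩ := a.A_inv _ h2
      have h3 : ContDiffAt ℝ ∞ ContinuousLinearMap.inverse (a.A (a.φ.symm y)) := by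
        rw [← he]
        exact contDiffAt_map_inverse e
      refine ContDiffAt.comp_contDiffWithinAt (f := fun y => a.A (a.φ.symm y)) y h3 ?_
      exact (a.A_smooth.comp a.smooth_symm fun y hy => a.source_eq ▸ a.φ.map_target hy) y hy
    refine ContDiffOn.prodMk ?_ ?_
    · exact a.smooth_symm.comp contDiffOn_fst fun z hz => hz.1
    · exact (h.comp contDiffOn_fst fun z hz => hz.1).clm_apply contDiffOn_snd
  π_comp := fun z hz => a.πE_comp _ hz.1 _
  lam := a.lam
  lam_injective := a.lam_injective
  equivariant := fun g z hz => by
    have := DFunLike.congr_fun (a.A_equivariant g _ hz.1) z.2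
    ext
    · exact a.equivariant g _ hz.1
    · exact this
  full := fun g z hz w hw h => a.full g _ hz.1 _ hw.1 (congrArg Prod.fst h)

end Total

namespace OrbifoldVectorBundle

variable {H : Type*} [NormedAddCommGroup H] [NormedSpace ℝ H]
  {F : Type*} [NormedAddCommGroup F] [NormedSpace ℝ F]
  {X Y : Type*} [TopologicalSpace X] [TopologicalSpace Y]
  {Q : Orbifold H X} {p : Y → X}

theorem exists_rep (E : OrbifoldVectorBundle F Q p) (e : Y) :
    ∃ i, ∃ x ∈ (E.chart i).V, ∃ v, (E.chart i).πE (x, v) = e := by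
  obtain ⟨i, hi⟩ := E.cover (p e)
  exact ⟨i, (E.chart i).πE_surj e hi⟩

theorem continuous_proj (E : OrbifoldVectorBundle F Q p) : Continuous p := by
  rw [continuous_iff_continuousAt]
  intro e O hO
  obtain ⟨i, x, hx, v, rfl⟩ := E.exists_rep e
  set c := E.chart i
  rw [c.πE_proj x hx] at hO
  obtain ⟨O', hO'O, hO', hxO'⟩ := mem_nhds_iff.1 hO
  have h1 : IsOpen (c.V ∩ c.π ⁻¹' O') := c.π_cont.isOpen_inter_preimage c.isOpen_V hO'
  have h2 : IsOpen (c.πE '' ((c.V ∩ c.π ⁻¹' O') ×ˢ univ)) :=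
    c.πE_open _ (prod_mono inter_subset_left Subset.rfl) (h1.prod isOpen_univ)
  rw [Filter.mem_map]
  refine Filter.mem_of_superset (h2.mem_nhds ⟨(x, v), ⟨⟨hx, hxO'⟩, trivial⟩, rfl⟩) ?_
  rintro _ ⟨⟨y, w⟩, ⟨⟨hy, hyO⟩, -⟩, rfl⟩
  apply hO'O
  rw [c.πE_proj y hy]
  exact hyO

theorem t2_total (E : OrbifoldVectorBundle F Q p) : T2Space Y := by
  refine ⟨fun e e' hne => ?_⟩
  by_cases hp : p e = p e'
  · obtain ⟨i, x, hx, v, rfl⟩ := E.exists_rep e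
    rw [(E.chart i).πE_proj x hx] at hp
    obtain ⟨y, hy, w, rfl⟩ := (E.chart i).πE_surj e' (hp ▸ mem_image_of_mem _ hx)
    exact (E.chart i).total.separate (x := (x, v)) (y := (y, w)) ⟨hx, trivial⟩ ⟨hy, trivial⟩ hne
  · have := Q.t2
    obtain ⟨u, v, hu, hv, h1, h2, h3⟩ := t2_separation hp
    exact ⟨p ⁻¹' u, p ⁻¹' v, hu.preimage E.continuous_proj, hv.preimage E.continuous_proj, h1, h2,
      h3.preimage p⟩

/-- The total space of an orbifold vector bundle, as an orbifold with the charts `(V × F, G, πE)`. -/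
def total [FiniteDimensional ℝ F] (E : OrbifoldVectorBundle F Q p) : Orbifold (H × F) Y where
  t2 := E.t2_total
  ι := E.ι
  chart i := (E.chart i).total
  cover e := by
    obtain ⟨i, x, hx, v, h⟩ := E.exists_rep e
    exact ⟨i, (x, v), ⟨hx, trivial⟩, h⟩
  compat i j e he := by
    have := FiniteDimensional.complete ℝ F
    obtain ⟨⟨z, hz, hze⟩, ⟨w, hw, hwe⟩⟩ := he
    have h1 : p e = (E.chart i).π z.1 := by rw [← hze]; exact (E.chart i).πE_proj _ hz.1 _
    have h2 : p e = (E.chart j).π w.1 := by rw [← hwe]; exact (E.chart j).πE_proj _ hw.1 _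
    obtain ⟨c, hc, ⟨a⟩, ⟨b⟩⟩ := E.compat i j (p e)
      ⟨h1 ▸ mem_image_of_mem _ hz.1, h2 ▸ mem_image_of_mem _ hw.1⟩
    obtain ⟨x, hx, v, h⟩ := c.πE_surj e hc
    exact ⟨c.total, ⟨(x, v), ⟨hx, trivial⟩, h⟩, ⟨a.total⟩, ⟨b.total⟩⟩

end OrbifoldVectorBundle

namespace OrbifoldChart

variable {H : Type*} [NormedAddCommGroup H] [NormedSpace ℝ H] {X : Type*} [TopologicalSpace X]

/-- `φ` is a transition between the charts `c` and `d`: a diffeomorphism from an open subset of `c.V`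
to an open subset of `d.V` over the identity of `X`. These are, locally, the injections of charts
composed with elements of the local groups. -/
structure IsTransition (c d : OrbifoldChart H X) (φ : OpenPartialHomeomorph H H) : Prop where
  source_subset : φ.source ⊆ c.V
  target_subset : φ.target ⊆ d.V
  smooth : ContDiffOn ℝ ∞ φ φ.source
  smooth_symm : ContDiffOn ℝ ∞ φ.symm φ.target
  π_comp : ∀ x ∈ φ.source, d.π (φ x) = c.π x

/-- The tangent vectors `z = (x, v)` to `c.V` and `w = (y, u)` to `d.V` are identified by the
differential of a transition. -/
def TangentRel (c d : OrbifoldChart H X) (z w : H × H) : Prop :=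
  ∃ φ, IsTransition c d φ ∧ z.1 ∈ φ.source ∧ φ z.1 = w.1 ∧ fderiv ℝ φ z.1 z.2 = w.2

theorem IsTransition.symm {c d : OrbifoldChart H X} {φ : OpenPartialHomeomorph H H}
    (h : IsTransition c d φ) : IsTransition d c φ.symm where
  source_subset := h.target_subset
  target_subset := h.source_subset
  smooth := h.smooth_symm
  smooth_symm := by simpa using h.smooth
  π_comp x hx := by
    rw [← h.π_comp _ (φ.map_target hx), φ.right_inv hx]

theorem IsTransition.trans {c d e : OrbifoldChart H X} {φ ψ : OpenPartialHomeomorph H H}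
    (h : IsTransition c d φ) (k : IsTransition d e ψ) : IsTransition c e (φ.trans ψ) where
  source_subset x hx := by
    rw [OpenPartialHomeomorph.trans_source] at hx
    exact h.source_subset hx.1
  target_subset x hx := by
    rw [OpenPartialHomeomorph.trans_target] at hx
    exact k.target_subset hx.1
  smooth := by
    rw [OpenPartialHomeomorph.coe_trans, OpenPartialHomeomorph.trans_source]
    exact k.smooth.comp (h.smooth.mono inter_subset_left) fun x hx => hx.2
  smooth_symm := by
    rw [OpenPartialHomeomorph.coe_trans_symm, OpenPartialHomeomorph.trans_target]
    exact h.smooth_symm.comp (k.smooth_symm.mono inter_subset_left) fun x hx => hx.2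
  π_comp x hx := by
    rw [OpenPartialHomeomorph.trans_source] at hx
    rw [OpenPartialHomeomorph.coe_trans, Function.comp_apply, k.π_comp _ hx.2, h.π_comp _ hx.1]

theorem IsTransition.differentiableAt {c d : OrbifoldChart H X} {φ : OpenPartialHomeomorph H H}
    (h : IsTransition c d φ) {x : H} (hx : x ∈ φ.source) : DifferentiableAt ℝ φ x :=
  (h.smooth.contDiffAt (φ.open_source.mem_nhds hx)).differentiableAt (by simp)

/-- The action of a group element as a local diffeomorphism. -/
def actHomeo (c : OrbifoldChart H X) (g : c.G) : OpenPartialHomeomorph H H where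
  toFun := c.act g
  invFun := c.act g⁻¹
  source := c.V
  target := c.V
  map_source' := c.act_mem g
  map_target' := c.act_mem g⁻¹
  left_inv' x hx := by rw [← c.act_mul _ _ _ hx, inv_mul_cancel, c.act_one _ hx]
  right_inv' x hx := by rw [← c.act_mul _ _ _ hx, mul_inv_cancel, c.act_one _ hx]
  open_source := c.isOpen_V
  open_target := c.isOpen_V
  continuousOn_toFun := (c.act_smooth g).continuousOn
  continuousOn_invFun := (c.act_smooth g⁻¹).continuousOn

theorem isTransition_act (c : OrbifoldChart H X) (g : c.G) : IsTransition c c (c.actHomeo g) where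
  source_subset := Subset.rfl
  target_subset := Subset.rfl
  smooth := c.act_smooth g
  smooth_symm := c.act_smooth g⁻¹
  π_comp x hx := ((c.π_eq_iff x hx _ (c.act_mem g x hx)).2 ⟨g, rfl⟩).symm

theorem Injection.isTransition {c d : OrbifoldChart H X} (a : c.Injection d) :
    IsTransition c d a.φ where
  source_subset := a.source_eq.subset
  target_subset := a.target_subset
  smooth := a.smooth
  smooth_symm := a.smooth_symm
  π_comp x hx := a.π_comp x (a.source_eq ▸ hx)

theorem TangentRel.refl (c : OrbifoldChart H X) {z : H × H} (hz : z.1 ∈ c.V) :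
    TangentRel c c z z := by
  refine ⟨OpenPartialHomeomorph.ofSet c.V c.isOpen_V, ⟨Subset.rfl, Subset.rfl, ?_, ?_, ?_⟩, hz, rfl,
    ?_⟩
  · simpa using contDiffOn_id
  · simpa using contDiffOn_id
  · simp
  · simp

theorem TangentRel.symm {c d : OrbifoldChart H X} {z w : H × H} (h : TangentRel c d z w) :
    TangentRel d c w z := by
  obtain ⟨φ, hφ, hz, h1, h2⟩ := h
  have hw : w.1 ∈ φ.target := h1 ▸ φ.map_source hz
  refine ⟨φ.symm, hφ.symm, hw, by rw [← h1, φ.left_inv hz], ?_⟩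
  have h3 : HasFDerivAt φ (fderiv ℝ φ z.1) (φ.symm w.1) := by
    rw [← h1, φ.left_inv hz]
    exact (hφ.differentiableAt hz).hasFDerivAt
  have h4 := h3.comp w.1 (hφ.symm.differentiableAt hw).hasFDerivAt
  have h5 : HasFDerivAt φ.symm (fderiv ℝ φ.symm w.1) (φ z.1) := by
    rw [h1]
    exact (hφ.symm.differentiableAt hw).hasFDerivAt
  have h6 := h5.comp z.1 (hφ.differentiableAt hz).hasFDerivAt
  have h7 : HasFDerivAt (φ.symm ∘ φ) (ContinuousLinearMap.id ℝ H) z.1 := by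
    refine (hasFDerivAt_id z.1).congr_of_eventuallyEq ?_
    filter_upwards [φ.open_source.mem_nhds hz] with x hx
    exact φ.left_inv hx
  have h8 := DFunLike.congr_fun (h6.unique h7) z.2
  rw [← h2]
  exact h8

theorem TangentRel.trans {c d e : OrbifoldChart H X} {z w u : H × H} (h : TangentRel c d z w)
    (k : TangentRel d e w u) : TangentRel c e z u := by
  obtain ⟨φ, hφ, hz, h1, h2⟩ := h
  obtain ⟨ψ, hψ, hw, h3, h4⟩ := k
  refine ⟨φ.trans ψ, hφ.trans hψ, ?_, ?_, ?_⟩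
  · rw [OpenPartialHomeomorph.trans_source]
    exact ⟨hz, by rw [mem_preimage, h1]; exact hw⟩
  · rw [OpenPartialHomeomorph.coe_trans, Function.comp_apply, h1, h3]
  · rw [OpenPartialHomeomorph.coe_trans, fderiv_comp _ (h1 ▸ hψ.differentiableAt hw)
      (hφ.differentiableAt hz), ContinuousLinearMap.comp_apply, h1, h2, h4]

theorem TangentRel.mem_left {c d : OrbifoldChart H X} {z w : H × H} (h : TangentRel c d z w) :
    z.1 ∈ c.V := by
  obtain ⟨φ, hφ, hz, -⟩ := h
  exact hφ.source_subset hz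

theorem TangentRel.π_eq {c d : OrbifoldChart H X} {z w : H × H} (h : TangentRel c d z w) :
    c.π z.1 = d.π w.1 := by
  obtain ⟨φ, hφ, hz, h1, -⟩ := h
  rw [← h1, hφ.π_comp _ hz]

/-- At each point, a transition from a chart to itself agrees to first order with the action of a
group element. -/
theorem IsTransition.exists_act [CompleteSpace H] {c : OrbifoldChart H X}
    {φ : OpenPartialHomeomorph H H} (h : IsTransition c c φ) {x : H} (hx : x ∈ φ.source) :
    ∃ g, c.act g x = φ x ∧ fderiv ℝ (c.act g) x = fderiv ℝ φ x := by
  have key : ∃ g, x ∈ closure (interior {y | y ∈ φ.source ∧ c.act g y = φ y}) := by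
    by_contra! hcon
    have ho : IsOpen (φ.source ∩ ⋂ g, (closure (interior {y | y ∈ φ.source ∧ c.act g y = φ y}))ᶜ) :=
      φ.open_source.inter (isOpen_iInter_of_finite fun g => isClosed_closure.isOpen_compl)
    set N := φ.source ∩ ⋂ g, (closure (interior {y | y ∈ φ.source ∧ c.act g y = φ y}))ᶜ with hN
    have hxN : x ∈ N := ⟨hx, mem_iInter.2 hcon⟩
    have : BaireSpace N := ho.baireSpace
    have : Nonempty N := ⟨⟨x, hxN⟩⟩
    obtain ⟨g, hg⟩ := nonempty_interior_of_iUnion_of_closed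
      (f := fun g : c.G => {y : N | c.act g y = φ y}) (fun g => by
        have h1 : Continuous fun y : N => c.act g y :=
          ((c.act_smooth g).continuousOn.mono
            fun y hy => h.source_subset hy.1).domRestrict
        have h2 : Continuous fun y : N => φ y :=
          (φ.continuousOn.mono fun y hy => hy.1).domRestrict
        exact isClosed_eq h1 h2) (by
        rw [eq_univ_iff_forall]
        intro y
        obtain ⟨g, hg⟩ := (c.π_eq_iff y (h.source_subset y.2.1) (φ y)
          (h.target_subset (φ.map_source y.2.1))).1 (h.π_comp _ y.2.1).symm
        exact mem_iUnion.2 ⟨g, hg⟩)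
    obtain ⟨y, hy⟩ := hg
    have h3 : (y : H) ∈ interior {y | y ∈ φ.source ∧ c.act g y = φ y} := by
      rw [mem_interior]
      refine ⟨Subtype.val '' interior {y : N | c.act g y = φ y}, ?_,
        ho.isOpenMap_subtype_val _ isOpen_interior, mem_image_of_mem _ hy⟩
      rintro _ ⟨u, hu, rfl⟩
      have h4 : u ∈ {y : N | c.act g y = φ y} := interior_subset hu
      exact ⟨u.2.1, h4⟩
    exact (mem_iInter.1 y.2.2 g) (subset_closure h3)
  obtain ⟨g, hg⟩ := key
  refine ⟨g, ?_⟩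
  have hxV := h.source_subset hx
  have : (𝓝[interior {y | y ∈ φ.source ∧ c.act g y = φ y}] x).NeBot :=
    mem_closure_iff_nhdsWithin_neBot.1 hg
  have hmem : ∀ᶠ y in 𝓝[interior {y | y ∈ φ.source ∧ c.act g y = φ y}] x,
      y ∈ interior {y | y ∈ φ.source ∧ c.act g y = φ y} := eventually_mem_nhdsWithin
  constructor
  · have h1 : ContinuousAt (c.act g) x :=
      (c.act_smooth g).continuousOn.continuousAt (c.isOpen_V.mem_nhds hxV)
    have h2 : ContinuousAt φ x := φ.continuousAt hx
    refine tendsto_nhds_unique_of_eventuallyEq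
      (l := 𝓝[interior {y | y ∈ φ.source ∧ c.act g y = φ y}] x) (h1.mono_left nhdsWithin_le_nhds)
      (h2.mono_left nhdsWithin_le_nhds) ?_
    filter_upwards [hmem] with y hy
    exact (interior_subset hy).2
  · have h1 : ContinuousAt (fderiv ℝ (c.act g)) x :=
      ((c.act_smooth g).continuousOn_fderiv_of_isOpen c.isOpen_V (by simp)).continuousAt
        (c.isOpen_V.mem_nhds hxV)
    have h2 : ContinuousAt (fderiv ℝ φ) x :=
      (h.smooth.continuousOn_fderiv_of_isOpen φ.open_source (by simp)).continuousAt
        (φ.open_source.mem_nhds hx)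
    refine tendsto_nhds_unique_of_eventuallyEq
      (l := 𝓝[interior {y | y ∈ φ.source ∧ c.act g y = φ y}] x) (h1.mono_left nhdsWithin_le_nhds)
      (h2.mono_left nhdsWithin_le_nhds) ?_
    filter_upwards [hmem] with y hy
    refine Filter.EventuallyEq.fderiv_eq ?_
    filter_upwards [isOpen_interior.mem_nhds hy] with u hu
    exact (interior_subset hu).2

theorem tangentRel_self_iff [CompleteSpace H] (c : OrbifoldChart H X) {z w : H × H}
    (hz : z.1 ∈ c.V) :
    TangentRel c c z w ↔ ∃ g, c.act g z.1 = w.1 ∧ fderiv ℝ (c.act g) z.1 z.2 = w.2 := by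
  constructor
  · rintro ⟨φ, hφ, hz, h1, h2⟩
    obtain ⟨g, h3, h4⟩ := hφ.exists_act hz
    exact ⟨g, h3.trans h1, by rw [h4, h2]⟩
  · rintro ⟨g, h1, h2⟩
    exact ⟨c.actHomeo g, c.isTransition_act g, hz, h1, h2⟩

/-- Any two points of two charts over the same point of `X` are related by a transition. -/
def Joined (c d : OrbifoldChart H X) : Prop :=
  ∀ x ∈ c.V, ∀ y ∈ d.V, c.π x = d.π y → ∃ φ, IsTransition c d φ ∧ x ∈ φ.source ∧ φ x = y

theorem joined_of_equivAt {c d : OrbifoldChart H X}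
    (h : ∀ q ∈ c.U ∩ d.U, c.EquivAt d q) : Joined c d := by
  intro x hx y hy hxy
  obtain ⟨e, ⟨u, hu, hue⟩, ⟨a⟩, ⟨b⟩⟩ := h (c.π x) ⟨mem_image_of_mem _ hx, hxy ▸ mem_image_of_mem _ hy⟩
  have hua : u ∈ a.φ.source := a.source_eq ▸ hu
  have hub : u ∈ b.φ.source := b.source_eq ▸ hu
  have h1 : c.π x = c.π (a.φ u) := by rw [a.π_comp u hu, hue]
  have h2 : d.π (b.φ u) = d.π y := by rw [b.π_comp u hu, hue, hxy]
  obtain ⟨g, hg⟩ := (c.π_eq_iff x hx _ (a.target_subset (a.φ.map_source hua))).1 h1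
  obtain ⟨k, hk⟩ := (d.π_eq_iff _ (b.target_subset (b.φ.map_source hub)) y hy).1 h2
  have hg' : c.actHomeo g x = a.φ u := hg
  have hk' : d.actHomeo k (b.φ u) = y := hk
  refine ⟨((c.actHomeo g).trans a.φ.symm).trans (b.φ.trans (d.actHomeo k)),
    ((c.isTransition_act g).trans a.isTransition.symm).trans
      (b.isTransition.trans (d.isTransition_act k)), ?_, ?_⟩
  · simp only [OpenPartialHomeomorph.trans_source, mem_inter_iff, mem_preimage,
      OpenPartialHomeomorph.coe_trans, Function.comp_apply, hg', OpenPartialHomeomorph.symm_source,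
      a.φ.left_inv hua]
    exact ⟨⟨hx, a.φ.map_source hua⟩, hub, b.target_subset (b.φ.map_source hub)⟩
  · simp only [OpenPartialHomeomorph.coe_trans, Function.comp_apply, hg', a.φ.left_inv hua, hk']

theorem Joined.of_injection {c c' d : OrbifoldChart H X} (h : Joined c' d) (a : c.Injection c') :
    Joined c d := by
  intro x hx y hy hxy
  have hxa : x ∈ a.φ.source := a.source_eq ▸ hx
  obtain ⟨φ, hφ, h1, h2⟩ := h (a.φ x) (a.target_subset (a.φ.map_source hxa)) y hy
    ((a.π_comp x hx).trans hxy)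
  refine ⟨a.φ.trans φ, a.isTransition.trans hφ, ?_, ?_⟩
  · rw [OpenPartialHomeomorph.trans_source]
    exact ⟨hxa, h1⟩
  · rw [OpenPartialHomeomorph.coe_trans, Function.comp_apply, h2]

end OrbifoldChart

namespace Orbifold

open OrbifoldChart

variable {H : Type*} [NormedAddCommGroup H] [NormedSpace ℝ H] {X : Type*} [TopologicalSpace X]

/-- The disjoint union of the tangent bundles `V × H` of the charts of an orbifold. -/
abbrev PreTangent (Q : Orbifold H X) : Type _ := Σ i : Q.ι, {z : H × H // z.1 ∈ (Q.chart i).V}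

/-- The identification of tangent vectors in charts under the differentials of the transitions. -/
def tangentSetoid (Q : Orbifold H X) : Setoid Q.PreTangent where
  r s t := TangentRel (Q.chart s.1) (Q.chart t.1) s.2.1 t.2.1
  iseqv :=
    { refl := fun s => TangentRel.refl _ s.2.2
      symm := fun h => h.symm
      trans := fun h k => h.trans k }

/-- The total space `TQ` of the orbifold tangent bundle, with the quotient topology. -/
def TangentSpace (Q : Orbifold H X) : Type _ := Quotient Q.tangentSetoid

instance (Q : Orbifold H X) : TopologicalSpace Q.TangentSpace :=
  inferInstanceAs (TopologicalSpace (Quotient Q.tangentSetoid))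

/-- The point of `TQ` given by the tangent vector `z` in the chart `i`. -/
def tangentMk (Q : Orbifold H X) (i : Q.ι) (z : {z : H × H // z.1 ∈ (Q.chart i).V}) :
    Q.TangentSpace := Quotient.mk Q.tangentSetoid ⟨i, z⟩

/-- The projection `TQ → Q`. -/
def tangentProj (Q : Orbifold H X) : Q.TangentSpace → X :=
  Quotient.lift (fun s : Q.PreTangent => (Q.chart s.1).π s.2.1.1) fun _ _ h => TangentRel.π_eq h

theorem tangentMk_eq_iff (Q : Orbifold H X) {i j : Q.ι} (z : {z : H × H // z.1 ∈ (Q.chart i).V})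
    (w : {z : H × H // z.1 ∈ (Q.chart j).V}) :
    Q.tangentMk i z = Q.tangentMk j w ↔ TangentRel (Q.chart i) (Q.chart j) z.1 w.1 :=
  Quotient.eq (r := Q.tangentSetoid)

theorem continuous_tangentMk (Q : Orbifold H X) (i : Q.ι) : Continuous (Q.tangentMk i) :=
  continuous_quotient_mk'.comp continuous_sigmaMk

theorem exists_tangentMk (Q : Orbifold H X) (t : Q.TangentSpace) : ∃ i z, Q.tangentMk i z = t := by
  obtain ⟨⟨i, z⟩, rfl⟩ := Quotient.exists_rep t
  exact ⟨i, z, rfl⟩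

theorem isOpen_tangent_iff (Q : Orbifold H X) {O : Set Q.TangentSpace} :
    IsOpen O ↔ ∀ i, IsOpen (Q.tangentMk i ⁻¹' O) :=
  (isQuotientMap_quotient_mk' (s := Q.tangentSetoid)).isOpen_preimage.symm.trans isOpen_sigma_iff

/-- `T (x, v)` is the point of `TQ` given by the tangent vector `(x, v)` of `c.V`. -/
def IsTangentMap (Q : Orbifold H X) (c : OrbifoldChart H X) (T : H × H → Q.TangentSpace) : Prop :=
  ∀ z : H × H, z.1 ∈ c.V → ∃ i w, T z = Q.tangentMk i w ∧ TangentRel c (Q.chart i) z w.1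

theorem IsTangentMap.eq_mk_iff {Q : Orbifold H X} {c : OrbifoldChart H X}
    {T : H × H → Q.TangentSpace} (hT : Q.IsTangentMap c T) {z : H × H} (hz : z.1 ∈ c.V)
    (i : Q.ι) (w : {z : H × H // z.1 ∈ (Q.chart i).V}) :
    T z = Q.tangentMk i w ↔ TangentRel c (Q.chart i) z w.1 := by
  obtain ⟨j, u, h1, h2⟩ := hT z hz
  rw [h1, tangentMk_eq_iff]
  exact ⟨fun h => h2.trans h, fun h => h2.symm.trans h⟩

theorem IsTangentMap.eq_iff {Q : Orbifold H X} {c d : OrbifoldChart H X}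
    {T S : H × H → Q.TangentSpace} (hT : Q.IsTangentMap c T) (hS : Q.IsTangentMap d S)
    {z w : H × H} (hz : z.1 ∈ c.V) (hw : w.1 ∈ d.V) : T z = S w ↔ TangentRel c d z w := by
  obtain ⟨j, u, h1, h2⟩ := hS w hw
  rw [h1, hT.eq_mk_iff hz]
  exact ⟨fun h => h.trans h2.symm, fun h => h.trans h2⟩

theorem IsTangentMap.comp {Q : Orbifold H X} {c d : OrbifoldChart H X}
    {T : H × H → Q.TangentSpace} (hT : Q.IsTangentMap d T) (a : c.Injection d) :
    Q.IsTangentMap c fun z => T (a.φ z.1, fderiv ℝ a.φ z.1 z.2) := by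
  intro z hz
  have hza : z.1 ∈ a.φ.source := a.source_eq ▸ hz
  obtain ⟨i, w, h1, h2⟩ := hT (a.φ z.1, fderiv ℝ a.φ z.1 z.2)
    (a.target_subset (a.φ.map_source hza))
  exact ⟨i, w, h1, TangentRel.trans ⟨a.φ, a.isTransition, hza, rfl, rfl⟩ h2⟩

open Classical in
/-- The map `V × H → TQ` of the chart `i`, extended by a constant outside of `V × H`. -/
noncomputable def tangentMap (Q : Orbifold H X) (i : Q.ι) (z : H × H) : Q.TangentSpace :=
  if h : z.1 ∈ (Q.chart i).V then Q.tangentMk i ⟨z, h⟩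
  else Q.tangentMk i ⟨(_, 0), (Q.chart i).isConnected_V.nonempty.some_mem⟩

theorem isTangentMap_tangentMap (Q : Orbifold H X) (i : Q.ι) :
    Q.IsTangentMap (Q.chart i) (Q.tangentMap i) := fun z hz =>
  ⟨i, ⟨z, hz⟩, dif_pos hz, TangentRel.refl _ hz⟩

theorem IsTangentMap.continuousOn {Q : Orbifold H X} {c : OrbifoldChart H X}
    {T : H × H → Q.TangentSpace} (hT : Q.IsTangentMap c T) : ContinuousOn T (c.V ×ˢ univ) := by
  intro z hz
  apply ContinuousAt.continuousWithinAt
  obtain ⟨i, w, h1, φ, hφ, hzφ, h2, h3⟩ := hT z hz.1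
  have ho : IsOpen (φ.source ×ˢ (univ : Set H)) := φ.open_source.prod isOpen_univ
  have hd : ContinuousOn (fun u : H × H => (φ u.1, fderiv ℝ φ u.1 u.2)) (φ.source ×ˢ univ) := by
    refine ContinuousOn.prodMk (φ.continuousOn.comp continuousOn_fst fun u hu => hu.1) ?_
    exact ((hφ.smooth.continuousOn_fderiv_of_isOpen φ.open_source (by simp)).comp
      continuousOn_fst fun u hu => hu.1).clm_apply continuousOn_snd
  refine ContinuousOn.continuousAt (s := φ.source ×ˢ univ) ?_ (ho.mem_nhds ⟨hzφ, trivial⟩)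
  rw [continuousOn_iff_continuous_domRestrict]
  have h4 : Continuous fun u : φ.source ×ˢ (univ : Set H) =>
      Q.tangentMk i ⟨(φ u.1.1, fderiv ℝ φ u.1.1 u.1.2),
        hφ.target_subset (φ.map_source u.2.1)⟩ :=
    (Q.continuous_tangentMk i).comp
      ((continuousOn_iff_continuous_domRestrict.1 hd).subtype_mk _)
  convert h4 using 1
  ext u
  exact (hT.eq_mk_iff (hφ.source_subset u.2.1) i _).2 ⟨φ, hφ, u.2.1, rfl, rfl⟩

theorem IsTangentMap.isOpen_image {Q : Orbifold H X} {c : OrbifoldChart H X}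
    {T : H × H → Q.TangentSpace} (hT : Q.IsTangentMap c T) {O : Set (H × H)}
    (hO : O ⊆ c.V ×ˢ univ) (hOo : IsOpen O) : IsOpen (T '' O) := by
  rw [isOpen_tangent_iff]
  intro i
  rw [isOpen_iff_mem_nhds]
  rintro ⟨w, hw⟩ ⟨z, hz, hzw⟩
  obtain ⟨φ, hφ, hzφ, h1, h2⟩ := ((hT.eq_mk_iff (hO hz).1 i _).1 hzw).symm
  have hd : ContinuousOn (fun u : H × H => (φ u.1, fderiv ℝ φ u.1 u.2)) (φ.source ×ˢ univ) := by
    refine ContinuousOn.prodMk (φ.continuousOn.comp continuousOn_fst fun u hu => hu.1) ?_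
    exact ((hφ.smooth.continuousOn_fderiv_of_isOpen φ.open_source (by simp)).comp
      continuousOn_fst fun u hu => hu.1).clm_apply continuousOn_snd
  have h3 := hd.isOpen_inter_preimage (φ.open_source.prod isOpen_univ) hOo
  have h4 := (h3.preimage continuous_subtype_val).mem_nhds
    (x := (⟨w, hw⟩ : {z : H × H // z.1 ∈ (Q.chart i).V})) (by
      refine ⟨⟨hzφ, trivial⟩, ?_⟩
      change (φ w.1, fderiv ℝ φ w.1 w.2) ∈ O
      rw [h1, h2]
      exact hz)
  refine Filter.mem_of_superset h4 ?_
  rintro ⟨u, hu⟩ ⟨⟨hu1, -⟩, hu2⟩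
  refine ⟨_, hu2, (hT.eq_mk_iff (hO hu2).1 i _).2 ?_⟩
  exact TangentRel.symm ⟨φ, hφ, hu1, rfl, rfl⟩

/-- The chart `V × H → TQ`, with `G` acting by differentials, given by a chart of `Q`. -/
noncomputable def tangentChart [FiniteDimensional ℝ H] (Q : Orbifold H X) (c : OrbifoldChart H X)
    (hc : ∀ i, Joined (Q.chart i) c) (T : H × H → Q.TangentSpace) (hT : Q.IsTangentMap c T) :
    OrbibundleChart (H := H) H Q.tangentProj where
  toOrbifoldChart := c
  ρ g x := fderiv ℝ (c.act g) x
  ρ_one x hx := by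
    have h : c.act 1 =ᶠ[𝓝 x] id := by
      filter_upwards [c.isOpen_V.mem_nhds hx] with y hy using c.act_one y hy
    rw [h.fderiv_eq, fderiv_id]
  ρ_mul g h x hx := by
    have h1 : c.act (g * h) =ᶠ[𝓝 x] c.act g ∘ c.act h := by
      filter_upwards [c.isOpen_V.mem_nhds hx] with y hy using c.act_mul g h y hy
    rw [h1.fderiv_eq]
    exact fderiv_comp x
      ((c.isTransition_act g).differentiableAt (c.act_mem h x hx))
      ((c.isTransition_act h).differentiableAt hx)
  ρ_smooth g := (c.act_smooth g).fderiv_of_isOpen c.isOpen_V (by simp)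
  πE := T
  πE_cont := hT.continuousOn
  πE_open O hO hOo := hT.isOpen_image hO hOo
  πE_eq_iff x hx v y hy w := by
    have := FiniteDimensional.complete ℝ H
    rw [hT.eq_iff hT (z := (x, v)) (w := (y, w)) hx hy]
    exact c.tangentRel_self_iff (z := (x, v)) (w := (y, w)) hx
  πE_proj x hx v := by
    obtain ⟨i, w, h1, h2⟩ := hT (x, v) hx
    rw [h1]
    exact h2.π_eq.symm
  πE_surj e he := by
    obtain ⟨i, w, rfl⟩ := Q.exists_tangentMk e
    obtain ⟨x, hx, hxe⟩ := he
    obtain ⟨φ, hφ, h1, h2⟩ := hc i w.1.1 w.2 x hx hxe.symm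
    have h3 : TangentRel (Q.chart i) c w.1 (x, fderiv ℝ φ w.1.1 w.1.2) := ⟨φ, hφ, h1, h2, rfl⟩
    exact ⟨x, hx, _, (hT.eq_mk_iff hx i w).2 h3.symm⟩

/-- An injection `φ` of charts of `Q` gives the injection `(φ, dφ)` of charts of `TQ`. -/
noncomputable def tangentInjection [FiniteDimensional ℝ H] (Q : Orbifold H X)
    {c d : OrbifoldChart H X}
    {hc : ∀ i, Joined (Q.chart i) c} {T : H × H → Q.TangentSpace} {hT : Q.IsTangentMap c T}
    {hd : ∀ i, Joined (Q.chart i) d} {S : H × H → Q.TangentSpace} {hS : Q.IsTangentMap d S}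
    (a : c.Injection d) : (Q.tangentChart c hc T hT).Injection (Q.tangentChart d hd S hS) where
  toInjection := a
  A x := fderiv ℝ a.φ x
  A_smooth := by
    have := a.smooth.fderiv_of_isOpen (m := ∞) a.φ.open_source (by simp)
    rw [a.source_eq] at this
    exact this
  A_inv x hx := by
    have hx' : x ∈ a.φ.source := a.source_eq ▸ hx
    have h1 := (a.isTransition.differentiableAt hx').hasFDerivAt
    have h2 : HasFDerivAt a.φ.symm (fderiv ℝ a.φ.symm (a.φ x)) (a.φ x) :=
      (a.isTransition.symm.differentiableAt (a.φ.map_source hx')).hasFDerivAt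
    have h1' : HasFDerivAt a.φ (fderiv ℝ a.φ x) (a.φ.symm (a.φ x)) := by
      rw [a.φ.left_inv hx']; exact h1
    refine ContinuousLinearMap.IsInvertible.of_inverse (g := fderiv ℝ a.φ.symm (a.φ x)) ?_ ?_
    · refine (h1'.comp (a.φ x) h2).unique ((hasFDerivAt_id _).congr_of_eventuallyEq ?_)
      filter_upwards [a.φ.open_target.mem_nhds (a.φ.map_source hx')] with y hy
      exact a.φ.right_inv hy
    · refine (h2.comp x h1).unique ((hasFDerivAt_id _).congr_of_eventuallyEq ?_)
      filter_upwards [a.φ.open_source.mem_nhds hx'] with y hy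
      exact a.φ.left_inv hy
  A_equivariant g x hx := by
    have hx' : x ∈ a.φ.source := a.source_eq ▸ hx
    have hgx : c.act g x ∈ a.φ.source := a.source_eq ▸ c.act_mem g x hx
    have h1 : a.φ ∘ c.act g =ᶠ[𝓝 x] d.act (a.lam g) ∘ a.φ := by
      filter_upwards [c.isOpen_V.mem_nhds hx] with y hy using a.equivariant g y hy
    have h2 := fderiv_comp x (a.isTransition.differentiableAt hgx)
      ((c.isTransition_act g).differentiableAt hx)
    have h3 := fderiv_comp x
      ((d.isTransition_act (a.lam g)).differentiableAt (a.target_subset (a.φ.map_source hx')))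
      (a.isTransition.differentiableAt hx')
    exact h2.symm.trans ((h1.fderiv_eq (𝕜 := ℝ)).trans h3)
  πE_comp x hx v := by
    have hx' : x ∈ a.φ.source := a.source_eq ▸ hx
    refine ((hT.eq_iff hS (z := (x, v)) (w := (a.φ x, fderiv ℝ a.φ x v)) hx
      (a.target_subset (a.φ.map_source hx'))).2 ?_).symm
    exact ⟨a.φ, a.isTransition, hx', rfl, rfl⟩

theorem joined (Q : Orbifold H X) (i j : Q.ι) : Joined (Q.chart i) (Q.chart j) :=
  joined_of_equivAt (Q.compat i j)

theorem joined_of_injection (Q : Orbifold H X) {c : OrbifoldChart H X} {j : Q.ι}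
    (a : c.Injection (Q.chart j)) (i : Q.ι) : Joined (Q.chart i) c := by
  intro x hx y hy hxy
  obtain ⟨φ, hφ, h1, h2⟩ := (Q.joined j i).of_injection a y hy x hx hxy.symm
  exact ⟨φ.symm, hφ.symm, h2 ▸ φ.map_source h1, by rw [← h2, φ.left_inv h1]⟩

/-- The orbifold tangent bundle `TQ → Q`. -/
noncomputable def tangentBundle [FiniteDimensional ℝ H] (Q : Orbifold H X) :
    OrbifoldVectorBundle H Q Q.tangentProj where
  ι := Q.ι
  chart i := Q.tangentChart (Q.chart i) (fun j => Q.joined j i) (Q.tangentMap i)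
    (Q.isTangentMap_tangentMap i)
  base_compat i j := Q.compat i j
  cover := Q.cover
  compat i j q hq := by
    obtain ⟨e, he, ⟨a⟩, ⟨b⟩⟩ := Q.compat i j q hq
    exact ⟨Q.tangentChart e (Q.joined_of_injection a) _ ((Q.isTangentMap_tangentMap i).comp a), he,
      ⟨Q.tangentInjection a⟩, ⟨Q.tangentInjection b⟩⟩

end Orbifold

namespace OrbifoldVectorBundle

open OrbifoldChart Orbifold

variable {H : Type*} [NormedAddCommGroup H] [NormedSpace ℝ H]
  {F : Type*} [NormedAddCommGroup F] [NormedSpace ℝ F]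
  {X Y : Type*} [TopologicalSpace X] [TopologicalSpace Y]
  {Q : Orbifold H X} {p : Y → X}

theorem hasDerivAt_line {W : Type*} [NormedAddCommGroup W] [NormedSpace ℝ W] (z w : W) :
    HasDerivAt (fun t : ℝ => z + t • w) w 0 := by
  have := ((hasDerivAt_id (0 : ℝ)).smul_const w).const_add z
  rw [one_smul] at this
  exact this

theorem fst_eq_zero_of_tangentRel {c d : OrbibundleChart (H := H) F p} {z : H × F} {w : F}
    {z' : H × F} {w' : H × F} (h : TangentRel c.total d.total (z, (0, w)) (z', w')) : w'.1 = 0 := by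
  obtain ⟨φ, hφ, hz, h1, h2⟩ := h
  change φ z = z' at h1
  change fderiv ℝ φ z (0, w) = w' at h2
  change z ∈ φ.source at hz
  have hzV : z.1 ∈ c.V := (hφ.source_subset hz).1
  have hz'V : z'.1 ∈ d.V := by
    rw [← h1]
    exact (hφ.target_subset (φ.map_source hz)).1
  -- the curve in `V` below the image of the line `t ↦ (z.1, z.2 + t w)`
  set f : ℝ → H × F := fun t => z + t • ((0 : H), w) with hf
  have hf0 : f 0 = z := by simp [hf]
  have hfd : HasDerivAt f ((0 : H), w) 0 := hasDerivAt_line _ _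
  have hfs : ∀ᶠ t in 𝓝 (0 : ℝ), f t ∈ φ.source :=
    hfd.continuousAt.eventually (by rw [hf0]; exact φ.open_source.mem_nhds hz)
  have hφz : HasFDerivAt φ (fderiv ℝ φ z) (f 0) := by
    rw [hf0]; exact (hφ.differentiableAt hz).hasFDerivAt
  have hcd : HasDerivAt (fun t => φ (f t)) w' 0 := by
    have := hφz.comp_hasDerivAt (0 : ℝ) hfd
    rw [h2] at this
    exact this
  have hcd1 : HasDerivAt (fun t => (φ (f t)).1) w'.1 0 :=
    (ContinuousLinearMap.fst ℝ H F).hasFDerivAt.comp_hasDerivAt (0 : ℝ) hcd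
  have hfin : (Set.range fun g : d.G => d.act g z'.1).Finite := Set.finite_range _
  have hmem : ∀ᶠ t in 𝓝 (0 : ℝ), (φ (f t)).1 ∈ Set.range fun g : d.G => d.act g z'.1 := by
    filter_upwards [hfs] with t ht
    have h3 : p (d.πE (φ (f t))) = p (c.πE (f t)) := congrArg p (hφ.π_comp _ ht)
    have h4 : p (d.πE (φ z)) = p (c.πE z) := congrArg p (hφ.π_comp _ hz)
    have hdV := (hφ.target_subset (φ.map_source ht)).1
    have e1 : p (d.πE (φ (f t))) = d.π (φ (f t)).1 := d.πE_proj _ hdV _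
    have e2 : p (c.πE (f t)) = c.π (f t).1 := c.πE_proj _ (hφ.source_subset ht).1 _
    have e3 : p (d.πE z') = d.π z'.1 := d.πE_proj _ hz'V _
    have e4 : p (c.πE z) = c.π z.1 := c.πE_proj _ hzV _
    have e5 : (f t).1 = z.1 := by simp [hf]
    rw [h1] at h4
    have e6 : d.π z'.1 = d.π (φ (f t)).1 := by
      rw [← e3, h4, e4, ← e1, h3, e2, e5]
    exact (d.π_eq_iff _ hz'V _ hdV).1 e6
  have hev : ∀ᶠ t in 𝓝 (0 : ℝ), (φ (f t)).1 = z'.1 := by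
    have h3 : IsOpen ((Set.range fun g : d.G => d.act g z'.1) \ {z'.1})ᶜ :=
      (hfin.sdiff).isClosed.isOpen_compl
    have h4 := hcd1.continuousAt.eventually (h3.mem_nhds (by simp [hf0, h1]))
    filter_upwards [h4, hmem] with t ht ht'
    by_contra hne
    exact ht ⟨ht', hne⟩
  exact hcd1.unique ((hasDerivAt_const (0 : ℝ) z'.1).congr_of_eventuallyEq hev)

theorem fderiv_total_act (c : OrbibundleChart (H := H) F p) (g : c.G) {z : H × F} (hz : z.1 ∈ c.V)
    (w : F) : fderiv ℝ (c.total.act g) z (0, w) = (0, c.ρ g z.1 w) := by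
  set f : ℝ → H × F := fun t => z + t • ((0 : H), w) with hf
  have hf0 : f 0 = z := by simp [hf]
  have hfd : HasDerivAt f ((0 : H), w) 0 := hasDerivAt_line _ _
  have h1 : HasFDerivAt (c.total.act g) (fderiv ℝ (c.total.act g) z) (f 0) := by
    rw [hf0]
    exact ((c.total.isTransition_act g).differentiableAt (x := z) ⟨hz, trivial⟩).hasFDerivAt
  have h2 := h1.comp_hasDerivAt (0 : ℝ) hfd
  have h3 : HasDerivAt (fun t : ℝ => c.total.act g z + t • ((0 : H), c.ρ g z.1 w))
      ((0 : H), c.ρ g z.1 w) 0 := hasDerivAt_line _ _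
  refine h2.unique (h3.congr_of_eventuallyEq (Filter.Eventually.of_forall fun t => ?_))
  simp [hf, OrbibundleChart.total]

theorem fderiv_total_injection {c d : OrbibundleChart (H := H) F p} [CompleteSpace F]
    (a : c.Injection d) {z : H × F} (hz : z.1 ∈ c.V)
    (w : F) : fderiv ℝ a.total.φ z (0, w) = (0, a.A z.1 w) := by
  set f : ℝ → H × F := fun t => z + t • ((0 : H), w) with hf
  have hf0 : f 0 = z := by simp [hf]
  have hfd : HasDerivAt f ((0 : H), w) 0 := hasDerivAt_line _ _
  have h1 : HasFDerivAt a.total.φ (fderiv ℝ a.total.φ z) (f 0) := by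
    rw [hf0]
    exact (a.total.isTransition.differentiableAt (x := z) ⟨hz, trivial⟩).hasFDerivAt
  have h2 := h1.comp_hasDerivAt (0 : ℝ) hfd
  have h3 : HasDerivAt (fun t : ℝ => a.total.φ z + t • ((0 : H), a.A z.1 w))
      ((0 : H), a.A z.1 w) 0 := hasDerivAt_line _ _
  refine h2.unique (h3.congr_of_eventuallyEq (Filter.Eventually.of_forall fun t => ?_))
  simp [hf, OrbibundleChart.Injection.total]

variable [FiniteDimensional ℝ F]

/-- A tangent vector `t ∈ TE` of the total space is vertical if each lift `(z, (u, w))` of `t` to the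
tangent bundle `(V × F) × (H × F)` of a bundle chart is tangent to the fibers of `V × F → V`,
i.e. `u = 0`. -/
def IsVertical (E : OrbifoldVectorBundle F Q p) (t : E.total.TangentSpace) : Prop :=
  ∀ i z, E.total.tangentMk i z = t → z.1.2.1 = 0

/-- The total space `VE` of the vertical tangent bundle, a subspace of `TE`. -/
abbrev VerticalSpace (E : OrbifoldVectorBundle F Q p) : Type _ :=
  {t : E.total.TangentSpace // E.IsVertical t}

/-- The projection `VE → E`, the restriction of `TE → E`. -/
noncomputable def verticalProj (E : OrbifoldVectorBundle F Q p) (t : E.VerticalSpace) : Y :=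
  E.total.tangentProj t.1

theorem isVertical_iff (E : OrbifoldVectorBundle F Q p) {c : OrbibundleChart (H := H) F p}
    {T : (H × F) × (H × F) → E.total.TangentSpace} (hT : E.total.IsTangentMap c.total T)
    {z w : H × F} (hz : z.1 ∈ c.V) : E.IsVertical (T (z, w)) ↔ w.1 = 0 := by
  constructor
  · intro h
    obtain ⟨i, u, h1, h2⟩ := hT (z, w) ⟨hz, trivial⟩
    have h3 : u.1.2.1 = 0 := h i u h1.symm
    have h4 := h2.symm
    have h5 : u.1 = (u.1.1, ((0 : H), u.1.2.2)) := by rw [← h3]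
    rw [h5] at h4
    exact fst_eq_zero_of_tangentRel (c := E.chart i) (d := c) h4
  · intro h i u hu
    have h1 : TangentRel c.total (E.total.chart i) (z, w) u.1 :=
      (hT.eq_mk_iff (z := (z, w)) ⟨hz, trivial⟩ i u).1 hu.symm
    have h5 : w = ((0 : H), w.2) := by rw [← h]
    rw [h5] at h1
    exact fst_eq_zero_of_tangentRel (c := c) (d := E.chart i) h1

open Classical in
/-- The restriction `(z, w) ↦ T (z, (0, w))` of the chart map `T` of `TE` to vertical vectors
(extended by a constant outside of `(V × F) × F`). -/
noncomputable def verticalMap (E : OrbifoldVectorBundle F Q p) (c : OrbibundleChart (H := H) F p)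
    (T : (H × F) × (H × F) → E.total.TangentSpace) (hT : E.total.IsTangentMap c.total T)
    (z : (H × F) × F) : E.VerticalSpace :=
  if h : z.1.1 ∈ c.V then ⟨T (z.1, (0, z.2)), (E.isVertical_iff hT h).2 rfl⟩
  else ⟨T ((_, 0), (0, 0)), (E.isVertical_iff hT c.isConnected_V.nonempty.some_mem).2 rfl⟩

theorem coe_verticalMap (E : OrbifoldVectorBundle F Q p) {c : OrbibundleChart (H := H) F p}
    {T : (H × F) × (H × F) → E.total.TangentSpace} (hT : E.total.IsTangentMap c.total T)
    {z : (H × F) × F} (hz : z.1.1 ∈ c.V) : (E.verticalMap c T hT z).1 = T (z.1, (0, z.2)) := by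
  rw [verticalMap, dif_pos hz]

variable [FiniteDimensional ℝ H]

/-- The chart `(V × F) × F → VE` given by a bundle chart `V × F → E`: it is the part of the chart
`(V × F) × (H × F) → TE` consisting of vertical vectors. The differential of the action of `g` on
`V × F`, at `(x, v)` and on vertical vectors, is `ρ g x`. -/
noncomputable def verticalChart (E : OrbifoldVectorBundle F Q p)
    (c : OrbibundleChart (H := H) F p) (hc : ∀ i, Joined (E.total.chart i) c.total)
    (T : (H × F) × (H × F) → E.total.TangentSpace) (hT : E.total.IsTangentMap c.total T) :
    OrbibundleChart (H := H × F) F E.verticalProj where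
  toOrbifoldChart := c.total
  ρ g z := c.ρ g z.1
  ρ_one z hz := c.ρ_one z.1 hz.1
  ρ_mul g h z hz := c.ρ_mul g h z.1 hz.1
  ρ_smooth g := (c.ρ_smooth g).comp contDiffOn_fst fun z hz => hz.1
  πE := E.verticalMap c T hT
  πE_cont := by
    refine Topology.IsInducing.subtypeVal.continuousOn_iff.2 ?_
    have h1 : ContinuousOn (fun z : (H × F) × F => T (z.1, ((0 : H), z.2)))
        (c.total.V ×ˢ univ) :=
      hT.continuousOn.comp (by fun_prop) fun z hz => ⟨hz.1, trivial⟩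
    exact h1.congr fun z hz => E.coe_verticalMap hT hz.1.1
  πE_open O hO hOo := by
    have h1 : IsOpen ((c.total.V ×ˢ univ) ∩
        (fun z : (H × F) × (H × F) => (z.1, z.2.2)) ⁻¹' O) :=
      (c.total.isOpen_V.prod isOpen_univ).inter (hOo.preimage (by fun_prop))
    have h2 := (hT.isOpen_image inter_subset_left h1).preimage
      (continuous_subtype_val (p := E.IsVertical))
    convert h2 using 1
    ext t
    constructor
    · rintro ⟨z, hz, rfl⟩
      exact ⟨(z.1, (0, z.2)), ⟨⟨(hO hz).1, trivial⟩, hz⟩, (E.coe_verticalMap hT (hO hz).1.1).symm⟩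
    · rintro ⟨⟨z, u, w⟩, ⟨⟨hz, -⟩, hzO⟩, hzt⟩
      have h3 : u = 0 := (E.isVertical_iff hT (w := (u, w)) hz.1).1 (by rw [hzt]; exact t.2)
      refine ⟨(z, w), hzO, Subtype.ext ?_⟩
      rw [E.coe_verticalMap hT hz.1, ← hzt, h3]
  πE_eq_iff z hz w z' hz' w' := by
    have : FiniteDimensional ℝ (H × F) := inferInstance
    have := FiniteDimensional.complete ℝ (H × F)
    rw [Subtype.ext_iff, E.coe_verticalMap hT hz.1, E.coe_verticalMap hT hz'.1,
      hT.eq_iff hT (z := (z, (0, w))) (w := (z', (0, w'))) hz hz', c.total.tangentRel_self_iff hz]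
    refine exists_congr fun g => and_congr_right fun _ => ?_
    change fderiv ℝ (c.total.act g) z (0, w) = (0, w') ↔ _
    rw [fderiv_total_act c g hz.1]
    simp
  πE_proj z hz w := by
    change E.total.tangentProj (E.verticalMap c T hT (z, w)).1 = _
    rw [E.coe_verticalMap hT hz.1]
    exact (E.total.tangentChart c.total hc T hT).πE_proj z hz (0, w)
  πE_surj t ht := by
    obtain ⟨z, hz, ⟨u, w⟩, h⟩ := (E.total.tangentChart c.total hc T hT).πE_surj t.1 ht
    change T (z, (u, w)) = t.1 at h
    have h3 : u = 0 := (E.isVertical_iff hT (w := (u, w)) hz.1).1 (by rw [h]; exact t.2)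
    refine ⟨z, hz, w, Subtype.ext ?_⟩
    rw [E.coe_verticalMap hT hz.1, ← h, h3]

/-- An injection `(φ, A)` of bundle charts of `E` gives the injection of charts of `VE` over
`(x, v) ↦ (φ x, A x v)` with the fiber maps `A x`. -/
noncomputable def verticalInjection (E : OrbifoldVectorBundle F Q p) [CompleteSpace F]
    {c d : OrbibundleChart (H := H) F p}
    {hc : ∀ i, Joined (E.total.chart i) c.total}
    {T : (H × F) × (H × F) → E.total.TangentSpace} {hT : E.total.IsTangentMap c.total T}
    {hd : ∀ i, Joined (E.total.chart i) d.total}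
    {S : (H × F) × (H × F) → E.total.TangentSpace} {hS : E.total.IsTangentMap d.total S}
    (a : c.Injection d) : (E.verticalChart c hc T hT).Injection (E.verticalChart d hd S hS) where
  toInjection := a.total
  A z := a.A z.1
  A_smooth := a.A_smooth.comp contDiffOn_fst fun z hz => hz.1
  A_inv z hz := a.A_inv z.1 hz.1
  A_equivariant g z hz := a.A_equivariant g z.1 hz.1
  πE_comp z hz w := by
    have hz' : z ∈ a.total.φ.source := a.total.source_eq ▸ hz
    have hz'' : a.total.φ z ∈ d.total.V := a.total.target_subset (a.total.φ.map_source hz')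
    change E.verticalMap d S hS (a.total.φ z, a.A z.1 w) = E.verticalMap c T hT (z, w)
    rw [Subtype.ext_iff, E.coe_verticalMap hT hz.1, E.coe_verticalMap hS hz''.1]
    refine ((hT.eq_iff hS (z := (z, (0, w))) (w := (a.total.φ z, (0, a.A z.1 w))) hz hz'').2 ?_).symm
    exact ⟨a.total.φ, a.total.isTransition, hz', rfl, fderiv_total_injection a hz.1 w⟩

/-- The vertical tangent bundle `VE → E`, an orbifold vector bundle over the orbifold `E`. -/
noncomputable def verticalBundle (E : OrbifoldVectorBundle F Q p) :
    OrbifoldVectorBundle F E.total E.verticalProj where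
  ι := E.ι
  chart i := E.verticalChart (E.chart i) (fun j => E.total.joined j i) (E.total.tangentMap i)
    (E.total.isTangentMap_tangentMap i)
  base_compat i j := E.total.compat i j
  cover := E.total.cover
  compat i j e he := by
    have := FiniteDimensional.complete ℝ F
    obtain ⟨⟨z, hz, hze⟩, ⟨w, hw, hwe⟩⟩ := he
    have h1 : p e = (E.chart i).π z.1 := by rw [← hze]; exact (E.chart i).πE_proj _ hz.1 _
    have h2 : p e = (E.chart j).π w.1 := by rw [← hwe]; exact (E.chart j).πE_proj _ hw.1 _
    obtain ⟨c, hc, ⟨a⟩, ⟨b⟩⟩ := E.compat i j (p e)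
      ⟨h1 ▸ mem_image_of_mem _ hz.1, h2 ▸ mem_image_of_mem _ hw.1⟩
    obtain ⟨x, hx, v, h⟩ := c.πE_surj e hc
    exact ⟨E.verticalChart c (E.total.joined_of_injection (j := i) a.total) _
      ((E.total.isTangentMap_tangentMap i).comp a.total), ⟨(x, v), ⟨hx, trivial⟩, h⟩,
      ⟨E.verticalInjection a⟩, ⟨E.verticalInjection b⟩⟩

end OrbifoldVectorBundle

/-! The vertical bundle is the pullback of `E` along its own projection: in a chart, the tangent
space at `(x, v)` to the fiber over `x` is `F` itself, and both the group action and the changes of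
charts act on it by their linear parts at `x`, whatever `v` is. A section `s` of `E` therefore gives
a vertical field that is constant along each fiber, lifted by `(x, v) ↦ σ x`. A vertical field
restricted to the zero section gives a section of `E`, lifted by `x ↦ σ (x, 0)`. Neither operation
creates zeros.

The work lies in passing from lifts to maps on the quotients. A point of `E` over `π x` is only an
orbit of vectors under the stabilizer of `x`, and for a bad bundle even elements acting trivially on
the base may move vectors. A section comes with a lift in each chart separately, with no
compatibility assumed between charts. What saves the construction is equivariance: if `g` fixes `x`,
then `σ x = σ (g x) = ρ g x (σ x)`, so lifted values are fixed by the stabilizer. Distinct fixed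
vectors have distinct images in the quotient, so a section determines its lift, and lifts in
overlapping charts must correspond. This is `IsLift.exists_common`.

`exists_fiber_equiv` packages the consequences: between two chart points over the same `q` there is
a single linear isomorphism `B` that serves `E`, the vertical bundle, and the lifts of sections of
both. With it, the maps defined by choosing representatives are seen not to depend on the choice,
and `isZero_πE_iff` reduces nonvanishing to nonvanishing of lifts. -/

namespace OrbibundleChart

variable {H : Type*} [NormedAddCommGroup H] [NormedSpace ℝ H]
  {F : Type*} [NormedAddCommGroup F] [NormedSpace ℝ F]
  {X Y : Type*} [TopologicalSpace X] [TopologicalSpace Y] {p : Y → X}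

/-! ### Lifts of sections in charts, and their uniqueness. -/

/-- The map `σ` is an equivariant lift of the section `s` to the chart `c`. -/
structure IsLift (c : OrbibundleChart (H := H) F p) (s : X → Y) (σ : H → F) : Prop where
  equivariant : ∀ g, ∀ x ∈ c.V, σ (c.act g x) = c.ρ g x (σ x)
  covers : ∀ x ∈ c.V, c.πE (x, σ x) = s (c.π x)

/-- The action of a group element on a fiber is invertible. -/
theorem exists_ρ_equiv (c : OrbibundleChart (H := H) F p) (g : c.G) {x : H} (hx : x ∈ c.V) :
    ∃ e : F ≃L[ℝ] F, (e : F →L[ℝ] F) = c.ρ g x := by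
  -- `ρ` is a cocycle, so the inverse of `ρ g x` is `ρ g⁻¹` taken at the moved point `g x`, not at
  -- `x`.
  refine ContinuousLinearMap.IsInvertible.of_inverse (g := c.ρ g⁻¹ (c.act g x)) ?_ ?_
  · have h := c.ρ_mul g g⁻¹ _ (c.act_mem g x hx)
    rw [← c.act_mul _ _ _ hx, inv_mul_cancel, c.act_one _ hx, mul_inv_cancel,
      c.ρ_one _ (c.act_mem g x hx)] at h
    exact h.symm
  · have h := c.ρ_mul g⁻¹ g x hx
    rw [inv_mul_cancel, c.ρ_one _ hx] at h
    exact h.symm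

theorem πE_act (c : OrbibundleChart (H := H) F p) (g : c.G) {x : H} (hx : x ∈ c.V) (v : F) :
    c.πE (c.act g x, c.ρ g x v) = c.πE (x, v) :=
  ((c.πE_eq_iff x hx v _ (c.act_mem g x hx) _).2 ⟨g, rfl, rfl⟩).symm

theorem Injection.φ_mem {c d : OrbibundleChart (H := H) F p} (a : c.Injection d) {x : H}
    (hx : x ∈ c.V) : a.φ x ∈ d.V :=
  a.target_subset (a.φ.map_source (a.source_eq ▸ hx))

/-- Lifts of the same section to two charts correspond to each other under a pair of injections from
a common chart. -/
theorem IsLift.exists_common {c d e : OrbibundleChart (H := H) F p} {s : X → Y} {σ τ : H → F}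
    (hσ : c.IsLift s σ) (hτ : d.IsLift s τ) (a : e.Injection c) (b : e.Injection d) {z : H}
    (hz : z ∈ e.V) : ∃ u, a.A z u = σ (a.φ z) ∧ b.A z u = τ (b.φ z) := by
  obtain ⟨M, hM⟩ := a.A_inv z hz
  obtain ⟨N, hN⟩ := b.A_inv z hz
  obtain ⟨u, hu⟩ : ∃ u, a.A z u = σ (a.φ z) := ⟨M.symm (σ (a.φ z)), by simp [← hM]⟩
  obtain ⟨w, hw⟩ : ∃ w, b.A z w = τ (b.φ z) := ⟨N.symm (τ (b.φ z)), by simp [← hN]⟩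
  -- Pulled back to `e`, both lifted values represent the same point of `Y`, so they can differ only
  -- by an element of the stabilizer of `z`.
  have h : e.πE (z, u) = e.πE (z, w) := by
    rw [← a.πE_comp z hz, ← b.πE_comp z hz, hu, hw, hσ.covers _ (a.φ_mem hz),
      hτ.covers _ (b.φ_mem hz), a.π_comp z hz, b.π_comp z hz]
  obtain ⟨g, hg, hgu⟩ := (e.πE_eq_iff z hz u z hz w).1 h
  -- Since `g` fixes `z`, `lam g` fixes `φ z`, and equivariance makes it fix `σ (φ z)`. As `A z` is
  -- injective and intertwines the actions, `g` fixes `u`.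
  have h1 : a.A z (e.ρ g z u) = a.A z u := by
    have h2 := DFunLike.congr_fun (a.A_equivariant g z hz) u
    have h3 := a.equivariant g z hz
    simp only [ContinuousLinearMap.comp_apply] at h2
    rw [hg] at h2 h3
    rw [h2, hu, ← hσ.equivariant _ _ (a.φ_mem hz), ← h3]
  have h4 : u = w := by
    rw [← hM] at h1
    rw [← hgu]
    exact (M.injective h1).symm
  exact ⟨u, hu, h4 ▸ hw⟩

end OrbibundleChart

/-! ### Comparison of fibers between charts. -/

namespace OrbifoldVectorBundle

variable {H : Type*} [NormedAddCommGroup H] [NormedSpace ℝ H] [FiniteDimensional ℝ H]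
  {F : Type*} [NormedAddCommGroup F] [NormedSpace ℝ F] [FiniteDimensional ℝ F]
  {X Y : Type*} [TopologicalSpace X] [TopologicalSpace Y]
  {Q : Orbifold H X} {p : Y → X}

/-- Two points of charts over the same point of the base are related by a linear isomorphism of the
fibers which is compatible with the chart maps and the lifts of sections, both of the bundle and of
its vertical tangent bundle. -/
theorem exists_fiber_equiv (E : OrbifoldVectorBundle F Q p) {i j : E.ι} {x y : H}
    (hx : x ∈ (E.chart i).V) (hy : y ∈ (E.chart j).V)
    (hxy : (E.chart i).π x = (E.chart j).π y) :
    ∃ B : F ≃L[ℝ] F, (∀ v, (E.chart j).πE (y, B v) = (E.chart i).πE (x, v)) ∧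
      (∀ v w, (E.verticalBundle.chart j).πE ((y, B v), B w) =
        (E.verticalBundle.chart i).πE ((x, v), w)) ∧
      (∀ s σ τ, (E.chart i).IsLift s σ → (E.chart j).IsLift s τ → τ y = B (σ x)) ∧
      (∀ S σ τ, (E.verticalBundle.chart i).IsLift S σ → (E.verticalBundle.chart j).IsLift S τ →
        ∀ v, τ (y, B v) = B (σ (x, v))) := by
  have := FiniteDimensional.complete ℝ F
  obtain ⟨e, ⟨z, hz, hzq⟩, ⟨a⟩, ⟨b⟩⟩ := E.compat i j ((E.chart i).π x)
    ⟨mem_image_of_mem _ hx, hxy ▸ mem_image_of_mem _ hy⟩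
  -- The injections carry `z` only into the orbits of `x` and `y`; `g` and `h` make up the
  -- difference. They are not unique, so `B` below depends on choices, and only its existence is
  -- claimed.
  obtain ⟨g, rfl⟩ := ((E.chart i).π_eq_iff _ (a.φ_mem hz) x hx).1 ((a.π_comp z hz).trans hzq)
  obtain ⟨h, rfl⟩ := ((E.chart j).π_eq_iff _ (b.φ_mem hz) y hy).1
    ((b.π_comp z hz).trans (hzq.trans hxy))
  obtain ⟨M, hM⟩ := a.A_inv z hz
  obtain ⟨N, hN⟩ := b.A_inv z hz
  obtain ⟨R, hR⟩ := (E.chart i).exists_ρ_equiv g (a.φ_mem hz)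
  obtain ⟨L, hL⟩ := (E.chart j).exists_ρ_equiv h (b.φ_mem hz)
  have hM' (u) : a.A z u = M u := by rw [← hM]; rfl
  have hN' (u) : b.A z u = N u := by rw [← hN]; rfl
  have hR' (u) : (E.chart i).ρ g (a.φ z) u = R u := by rw [← hR]; rfl
  have hL' (u) : (E.chart j).ρ h (b.φ z) u = L u := by rw [← hL]; rfl
  -- Every vector over `x` is written in terms of a vector `u` over `z`. In this parametrization `B`
  -- sends `R (M u)` to `L (N u)`, and each claim about `B` becomes a statement about `u`.
  have hC (v : F) : ∃ u, v = R (M u) := ⟨M.symm (R.symm v), by simp⟩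
  set B : F ≃L[ℝ] F := ((M.trans R).symm).trans (N.trans L) with hB
  have hBC (u : F) : B (R (M u)) = L (N u) := by simp [hB]
  -- The chart map of the tangent bundle over `e` is pulled back along `a`, yet it serves for `b` as
  -- well: tangent maps are compared through `TangentRel`, so `verticalInjection` requires no
  -- relation between `T` and `b`.
  let T := fun w : (H × F) × (H × F) =>
    E.total.tangentMap i (a.total.φ w.1, fderiv ℝ a.total.φ w.1 w.2)
  have hT : E.total.IsTangentMap e.total T :=
    (E.total.isTangentMap_tangentMap i).comp a.total
  let e' := E.verticalChart e (E.total.joined_of_injection (j := i) a.total) T hT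
  let a' : e'.Injection (E.verticalBundle.chart i) :=
    E.verticalInjection (hd := fun k => E.total.joined k i) a
  let b' : e'.Injection (E.verticalBundle.chart j) :=
    E.verticalInjection (hd := fun k => E.total.joined k j) b
  have hz' (u : F) : (z, u) ∈ e'.V := ⟨hz, trivial⟩
  -- The base of the vertical bundle is the total space of `E`, so moving the base point `(z, u)`
  -- already involves the fiber maps `M` and `R`.
  have ha' (u : F) : (E.verticalBundle.chart i).act g (a'.φ (z, u)) =
      ((E.chart i).act g (a.φ z), R (M u)) := by
    rw [← hR', ← hM']; rfl
  have hb' (u : F) : (E.verticalBundle.chart j).act h (b'.φ (z, u)) =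
      ((E.chart j).act h (b.φ z), L (N u)) := by
    rw [← hL', ← hN']; rfl
  refine ⟨B, fun v => ?_, fun v w => ?_, fun s σ τ hσ hτ => ?_, fun S σ τ hσ hτ v => ?_⟩
  · obtain ⟨u, rfl⟩ := hC v
    rw [hBC, ← hL', ← hN', ← hR', ← hM', OrbibundleChart.πE_act _ _ (a.φ_mem hz),
      OrbibundleChart.πE_act _ _ (b.φ_mem hz), a.πE_comp z hz, b.πE_comp z hz]
  · obtain ⟨u, rfl⟩ := hC v
    obtain ⟨t, rfl⟩ := hC w
    have h1 := OrbibundleChart.πE_act (E.verticalBundle.chart i) g (a'.φ_mem (hz' u)) (a'.A (z, u) t)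
    have h2 := OrbibundleChart.πE_act (E.verticalBundle.chart j) h (b'.φ_mem (hz' u)) (b'.A (z, u) t)
    rw [a'.πE_comp _ (hz' u), ha'] at h1
    rw [b'.πE_comp _ (hz' u), hb'] at h2
    rw [hBC, hBC, ← hL' (N t), ← hN' t, ← hR' (M t), ← hM' t]
    exact h2.trans h1.symm
  · obtain ⟨u, h1, h2⟩ := hσ.exists_common hτ a b hz
    rw [hσ.equivariant _ _ (a.φ_mem hz), hτ.equivariant _ _ (b.φ_mem hz), ← h1, ← h2, hL', hN',
      hR', hM', hBC]
  · obtain ⟨u, rfl⟩ := hC v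
    obtain ⟨t, h1, h2⟩ := hσ.exists_common hτ a' b' (hz' u)
    have h3 := hσ.equivariant g _ (a'.φ_mem (hz' u))
    have h4 := hτ.equivariant h _ (b'.φ_mem (hz' u))
    rw [ha', ← h1] at h3
    rw [hb', ← h2] at h4
    -- The fiber maps of the vertical bundle at `(z, u)` are those of `E` at `z`, independent of
    -- `u`; hence the same `B` transports vertical vectors.
    change _ = (E.chart i).ρ g (a.φ z) (a.A z t) at h3
    change _ = (E.chart j).ρ h (b.φ z) (b.A z t) at h4
    rw [hBC, h3, h4, hL', hN', hR', hM', hBC]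

/-- `IsZero` allows the zero vector to be seen in any chart. Changes of charts and group elements
act linearly on fibers, so zero in one representative means zero in all. Applied to both bundles,
this translates nonvanishing of a section into nonvanishing of lifts. -/
theorem isZero_πE_iff (E : OrbifoldVectorBundle F Q p) {i : E.ι} {x : H}
    (hx : x ∈ (E.chart i).V) {v : F} : E.IsZero ((E.chart i).πE (x, v)) ↔ v = 0 := by
  constructor
  · rintro ⟨j, y, hy, h⟩
    have h1 := congrArg p h
    rw [(E.chart j).πE_proj y hy, (E.chart i).πE_proj x hx] at h1
    obtain ⟨B, hB, -⟩ := E.exists_fiber_equiv hy hx h1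
    rw [← hB 0, map_zero] at h
    obtain ⟨g, -, hg⟩ := ((E.chart i).πE_eq_iff x hx 0 x hx v).1 h
    rw [← hg, map_zero]
  · rintro rfl
    exact ⟨i, x, hx, rfl⟩

/-! ### The two implications. -/

/-- A nonvanishing section of a bundle is constant along the fibers when regarded as a vertical
vector field on the total space. -/
theorem HasNonvanishingSection.verticalBundle {E : OrbifoldVectorBundle F Q p}
    (hE : E.HasNonvanishingSection) : E.verticalBundle.HasNonvanishingSection := by
  obtain ⟨s, hs, hs0⟩ := hE
  choose σ hσ hσe hσc using hs.lift
  have hl (i) : (E.chart i).IsLift s (σ i) := ⟨hσe i, hσc i⟩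
  choose i x hx v hv using E.exists_rep
  -- The vertical field will be defined at `e` through a chosen representative `(x e, v e)`; this
  -- shows that any other representative gives the same value.
  have key (j) (z : H × F) (hz : z.1 ∈ (E.chart j).V) :
      (E.verticalBundle.chart j).πE (z, σ j z.1) =
        (E.verticalBundle.chart (i ((E.chart j).πE z))).πE
          ((x ((E.chart j).πE z), v ((E.chart j).πE z)),
            σ (i ((E.chart j).πE z)) (x ((E.chart j).πE z))) := by
    generalize he : (E.chart j).πE z = e
    obtain ⟨y, w⟩ := z
    have h1 := congrArg p ((hv e).trans he.symm)
    rw [(E.chart (i e)).πE_proj _ (hx e), (E.chart j).πE_proj y hz] at h1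
    obtain ⟨B, hB, hBv, hBs, -⟩ := E.exists_fiber_equiv (hx e) hz h1
    -- `B (v e)` need not equal `w`: the two agree only up to some `g` in the stabilizer of `y`.
    have h2 : (E.chart j).πE (y, B (v e)) = (E.chart j).πE (y, w) := by rw [hB, hv, he]
    obtain ⟨g, hg, hgw⟩ := ((E.chart j).πE_eq_iff y hz _ y hz _).1 h2
    rw [← hBv, ← hBs s (σ (i e)) (σ j) (hl _) (hl _)]
    refine (((E.verticalBundle.chart j).πE_eq_iff (y, B (v e)) ⟨hz, trivial⟩ _ (y, w)
      ⟨hz, trivial⟩ _).2 ⟨g, Prod.ext hg hgw, ?_⟩).symm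
    -- That `g` moves the foot point from `(y, B (v e))` to `(y, w)` but leaves the vertical vector
    -- `σ j y` unchanged, by equivariance of the lift.
    change (E.chart j).ρ g y (σ j y) = σ j y
    rw [← hσe j g y hz, hg]
  refine ⟨fun e => (E.verticalBundle.chart (i e)).πE ((x e, v e), σ (i e) (x e)),
    ⟨fun e => ?_, fun j => ⟨fun z => σ j z.1, ?_, ?_, ?_⟩⟩, fun e h => ?_⟩
  · exact ((E.verticalBundle.chart (i e)).πE_proj (x e, v e) ⟨hx e, trivial⟩ _).trans (hv e)
  · exact (hσ j).comp contDiffOn_fst fun z hz => hz.1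
  · exact fun g z hz => hσe j g z.1 hz.1
  · exact fun z hz => key j z hz.1
  -- A zero of the vertical field at `e` forces `σ (x e) = 0`, hence a zero of `s` at the base point
  -- `p e`.
  · have h1 := (E.verticalBundle.isZero_πE_iff (i := i e) (x := (x e, v e)) ⟨hx e, trivial⟩).1 h
    apply hs0 (p e)
    have h2 := hσc (i e) (x e) (hx e)
    rw [h1, ← (E.chart (i e)).πE_proj _ (hx e) (v e), hv] at h2
    exact ⟨i e, x e, hx e, h2⟩

/-- A nonvanishing vertical vector field on the total space restricts, along the zero section, to a
nonvanishing section. -/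
theorem HasNonvanishingSection.of_verticalBundle {E : OrbifoldVectorBundle F Q p}
    (hE : E.verticalBundle.HasNonvanishingSection) : E.HasNonvanishingSection := by
  obtain ⟨S, hS, hS0⟩ := hE
  choose σ hσ hσe hσc using hS.lift
  have hl (i) : (E.verticalBundle.chart i).IsLift S (σ i) := ⟨hσe i, hσc i⟩
  choose i hi using E.cover
  choose x hx hxq using hi
  refine ⟨fun q => (E.chart (i q)).πE (x q, σ (i q) (x q, 0)),
    ⟨fun q => ?_, fun j => ⟨fun y => σ j (y, 0), ?_, ?_, ?_⟩⟩, fun q h => ?_⟩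
  · rw [(E.chart (i q)).πE_proj _ (hx q), hxq]
  · exact (hσ j).comp (contDiff_id.prodMk contDiff_const).contDiffOn fun y hy => ⟨hy, trivial⟩
  · intro g y hy
    have h := hσe j g (y, 0) ⟨hy, trivial⟩
    change σ j ((E.chart j).act g y, (E.chart j).ρ g y 0) = (E.chart j).ρ g y (σ j (y, 0)) at h
    -- Linearity on fibers keeps the zero section invariant, so restricting the lift to it preserves
    -- equivariance.
    rwa [map_zero] at h
  · intro y hy
    obtain ⟨B, hB, -, -, hBS⟩ := E.exists_fiber_equiv (hx _) hy (hxq ((E.chart j).π y))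
    -- At the zero vector `B 0 = 0`, so the restricted lifts in the chosen chart and in chart `j`
    -- correspond under `B`, which is compatible with the chart maps.
    have h := hBS S _ _ (hl _) (hl j) 0
    rw [map_zero] at h
    exact (congrArg (fun w => (E.chart j).πE (y, w)) h).trans (hB _)
  · have h1 := (E.isZero_πE_iff (hx q)).1 h
    -- A zero of the restricted section at `q` is a zero of the vertical field at the zero vector
    -- over `q`.
    apply hS0 ((E.chart (i q)).πE (x q, 0))
    have h2 := hσc (i q) (x q, 0) ⟨hx q, trivial⟩
    rw [h1] at h2
    exact ⟨i q, (x q, 0), ⟨hx q, trivial⟩, h2⟩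

end OrbifoldVectorBundle

theorem mainTheorem6
    {H : Type*} [NormedAddCommGroup H] [NormedSpace ℝ H] [FiniteDimensional ℝ H]
    {F : Type*} [NormedAddCommGroup F] [NormedSpace ℝ F] [FiniteDimensional ℝ F]
    {X Y : Type*} [TopologicalSpace X] [TopologicalSpace Y]
    (Q : Orbifold H X) (p : Y → X) (E : OrbifoldVectorBundle F Q p) :
    E.HasNonvanishingSection ↔ E.verticalBundle.HasNonvanishingSection :=
  ⟨fun h => h.verticalBundle, fun h => h.of_verticalBundle⟩
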